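/- Let $\mathbb F_q$ be a finite field and let $(A_i,B_i,C_i)_{i\ge 1}$ be i.i.d. copies of a triple $(A,B,C)$ of independent $\mathbb F_q$-valued random variables such that $B\neq 0$ almost surely and $\Pr(C=c)>0$ for every $c\in\mathbb F_q$. Put $X=(A,B)$, $Y=A+B\cdot C$ and $Z=F(X,Y)=(Y-A)/B$ (so $Z=C$ almost surely), and let $X_i,Y_i,Z_i$ be the corresponding i.i.d. copies. A rate $R\in\mathbb R$ is called achievable if for every $\varepsilon>0$ and all sufficiently large $n$ there are a finite message set $\mathcal M$ with $|\mathcal M|\le 2^{nR}$, an encoder $f:(\mathbb F_q\times\mathbb F_q)^n\to\mathcal M$ and a decoder $g:\mathcal M\times\mathbb F_q^n\to\mathbb F_q^n$ such that $\Pr\big(g(f(X^n),Y^n)\neq Z^n\big)\le\varepsilon$. Let $R^*$ be the minimum achievable rate, i.e. the infimum of all achievable rates. Then, with entropies in bits, $R^*=H(X\mid Y)$. In particular, if $A$ is uniform over $\mathbb F_q$, then $R^*=H(B)+H(C)$. -/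

import Mathlib

open MeasureTheory ProbabilityTheory Filter

noncomputable section

namespace FunctionalCoding

/-- Shannon entropy, in bits, of a random variable with values in a finite set. -/
def entropy {Ω S : Type*} [MeasurableSpace Ω] [Fintype S] (μ : Measure Ω) (X : Ω → S) : ℝ :=
  -∑ x, μ.real {ω | X ω = x} * Real.logb 2 (μ.real {ω | X ω = x})

/-- Conditional Shannon entropy `H(X | Y)`, in bits, for finite-valued random variables:
`-∑ p(x, y) log₂ (p(x, y) / p(y))`. Terms with `p(x, y) = 0` vanish. -/
def condEntropy {Ω S T : Type*} [MeasurableSpace Ω] [Fintype S] [Fintype T]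
    (μ : Measure Ω) (X : Ω → S) (Y : Ω → T) : ℝ :=
  -∑ y, ∑ x, μ.real {ω | X ω = x ∧ Y ω = y} *
    Real.logb 2 (μ.real {ω | X ω = x ∧ Y ω = y} / μ.real {ω | Y ω = y})

/-- The letters `W 0, W 1, …` are independent and identically distributed. -/
structure IsMemoryless {Ω S : Type*} [MeasurableSpace Ω] [MeasurableSpace S]
    (μ : Measure Ω) (W : ℕ → Ω → S) : Prop where
  measurable : ∀ i, Measurable (W i)
  indep : iIndepFun W μ
  identDistrib : ∀ i, IdentDistrib (W i) (W 0) μ μ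

/-- Probability of error of a block code of length `n` with `m` messages: the encoder `f` observes
`X^n`, the decoder `g` observes the message and the side information `Y^n`, and an error occurs
when the output of the decoder differs from the vector `(φ (X_i, Y_i))_i`. -/
def errorProb {Ω S T V : Type*} [MeasurableSpace Ω] (μ : Measure Ω)
    (X : ℕ → Ω → S) (Y : ℕ → Ω → T) (φ : S → T → V) {n m : ℕ}
    (f : (Fin n → S) → Fin m) (g : Fin m → (Fin n → T) → (Fin n → V)) : ℝ :=
  μ.real {ω | g (f fun i => X i ω) (fun i => Y i ω) ≠ fun i : Fin n => φ (X i ω) (Y i ω)}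

/-- The rate `R` (bits per letter) is achievable for reconstructing `φ (X, Y)` from a coded version
of `X` with side information `Y` at the decoder: for every `ε > 0` and every sufficiently large
block length `n` there is a code with at most `2 ^ (n R)` messages and error probability
at most `ε`. -/
def Achievable {Ω S T V : Type*} [MeasurableSpace Ω] (μ : Measure Ω)
    (X : ℕ → Ω → S) (Y : ℕ → Ω → T) (φ : S → T → V) (R : ℝ) : Prop :=
  ∀ ε : ℝ, 0 < ε → ∀ᶠ n : ℕ in atTop,
    ∃ (m : ℕ) (f : (Fin n → S) → Fin m) (g : Fin m → (Fin n → T) → (Fin n → V)),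
      (m : ℝ) ≤ (2 : ℝ) ^ ((n : ℝ) * R) ∧ errorProb μ X Y φ f g ≤ ε

/-- `r` is the minimum achievable rate `R*`, that is, the infimum of all achievable rates.
(A real number can only be the greatest lower bound of a nonempty set of reals.) -/
def IsMinRate {Ω S T V : Type*} [MeasurableSpace Ω] (μ : Measure Ω)
    (X : ℕ → Ω → S) (Y : ℕ → Ω → T) (φ : S → T → V) (r : ℝ) : Prop :=
  IsGLB {R : ℝ | Achievable μ X Y φ R} r

/-- The function `F(X, Y) = (Y - A) / B` of `X = (A, B)` and `Y`. -/
def solveLine {K : Type*} [Field K] (x : K × K) (y : K) : K := (y - x.1) / x.2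

end FunctionalCoding

end

/-! Achievability is Slepian–Wolf coding: random binning at any rate above `H(X | Y)` lets the
decoder recover `X^n` itself, hence any function of the pair (`exists_binning`,
`achievable_of_condEntropy_lt`).

The converse shows that a good code for `φ (X, Y)` nearly reveals `X^n`. Changing one
side-information letter costs at most a constant factor in probability, since all `P s t` with the
same `s` are comparable. So the decoder can be run on every value of the `i`-th letter; when all
these runs are correct, their `i`-th outputs trace the whole section `φ (x i)`, which determines `x
i` (`mass_letterEstimate_ne_le`). Averaging over `i`, the estimate lies within a small Hamming
distance of `X^n` with high probability. A small Hamming ball has subexponential cost, so the `m`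
messages must account for typical blocks of conditional weight about `2 ^ (-n H)`, which forces the
rate up to `H` (`mass_ball_le`, `condEntropy_le_of_achievable`).

For `solveLine` a section is a line with nonzero slope, fixed by two values, and full support of `C`
gives comparability. When `A` is uniform so is `Y`, and the conditional weight of `(a, b)` given `t`
is the product of the weights of `B` and `C`. -/

namespace FunctionalCoding

/-- Total weight of a subset of a finite type. -/
noncomputable def mass {α : Type*} [Fintype α] (w : α → ℝ) (E : Set α) : ℝ :=
  ∑ a, E.indicator w a

/-! ### Finite weights: monotonicity, union bound, Markov. -/

section Mass

variable {α : Type*} [Fintype α] {w : α → ℝ}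

/-- Inclusion is asked only on the support, because the logarithmic formula for conditional weights
and the identification of source letters both fail off it. -/
theorem mass_mono_of_ne_zero (hw : ∀ a, 0 ≤ w a) {E F : Set α}
    (h : ∀ a, w a ≠ 0 → a ∈ E → a ∈ F) : mass w E ≤ mass w F := by
  classical
  refine Finset.sum_le_sum fun a _ => ?_
  by_cases h0 : w a = 0
  · rw [Set.indicator_apply, Set.indicator_apply, h0, ite_self, ite_self]
  by_cases hE : a ∈ E
  · rw [Set.indicator_of_mem hE, Set.indicator_of_mem (h a h0 hE)]
  · rw [Set.indicator_of_notMem hE]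
    exact Set.indicator_nonneg (fun a _ => hw a) a

theorem mass_mono (hw : ∀ a, 0 ≤ w a) {E F : Set α} (h : E ⊆ F) : mass w E ≤ mass w F :=
  mass_mono_of_ne_zero hw fun _ _ ha => h ha

theorem mass_union_le (hw : ∀ a, 0 ≤ w a) (E F : Set α) :
    mass w (E ∪ F) ≤ mass w E + mass w F := by
  unfold mass
  rw [← Finset.sum_add_distrib]
  refine Finset.sum_le_sum fun a _ => ?_
  have := hw a
  by_cases hE : a ∈ E <;> by_cases hF : a ∈ F <;> simp [hE, hF, this]

theorem mass_iUnion_le {ι : Type*} [Fintype ι] (hw : ∀ a, 0 ≤ w a) (E : ι → Set α) :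
    mass w (⋃ i, E i) ≤ ∑ i, mass w (E i) := by
  unfold mass
  rw [Finset.sum_comm]
  refine Finset.sum_le_sum fun a _ => ?_
  by_cases h : a ∈ ⋃ i, E i
  · obtain ⟨i, hi⟩ := Set.mem_iUnion.1 h
    rw [Set.indicator_of_mem h]
    calc w a = (E i).indicator w a := (Set.indicator_of_mem hi _).symm
      _ ≤ _ := Finset.single_le_sum (f := fun i => (E i).indicator w a)
        (fun j _ => Set.indicator_nonneg (fun a _ => hw a) a) (Finset.mem_univ i)
  · rw [Set.indicator_of_notMem h]
    exact Finset.sum_nonneg fun j _ => Set.indicator_nonneg (fun a _ => hw a) a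

theorem mass_univ : mass w Set.univ = ∑ a, w a := by simp [mass]

/-- Markov's inequality for finite weights. -/
theorem mul_mass_le_sum (hw : ∀ a, 0 ≤ w a) {d : α → ℝ} (hd : ∀ a, 0 ≤ d a) (r : ℝ) :
    r * mass w {a | r ≤ d a} ≤ ∑ a, w a * d a := by
  unfold mass
  rw [Finset.mul_sum]
  refine Finset.sum_le_sum fun a _ => ?_
  by_cases h : r ≤ d a
  · rw [Set.indicator_of_mem (show a ∈ {a | r ≤ d a} from h), mul_comm]
    exact mul_le_mul_of_nonneg_left h (hw a)
  · rw [Set.indicator_of_notMem (show a ∉ {a | r ≤ d a} from h), mul_zero]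
    exact mul_nonneg (hw a) (hd a)

theorem measureReal_preimage_eq_mass {Ω : Type*} [MeasurableSpace Ω] (μ : Measure Ω)
    [IsFiniteMeasure μ] [MeasurableSpace α] [MeasurableSingletonClass α] {V : Ω → α}
    (hV : Measurable V) (E : Set α) :
    μ.real (V ⁻¹' E) = mass (fun a => μ.real (V ⁻¹' {a})) E := by
  classical
  unfold mass
  have h : V ⁻¹' E = ⋃ a ∈ Finset.univ.filter (· ∈ E), V ⁻¹' {a} := by
    ext ω; simp
  rw [h, measureReal_biUnion_finset]
  · rw [Finset.sum_filter]
    exact Finset.sum_congr rfl fun a _ => by simp [Set.indicator_apply]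
  · intro a _ b _ hab
    refine Set.disjoint_left.2 fun ω h1 h2 => hab ?_
    simp only [Set.mem_preimage, Set.mem_singleton_iff] at h1 h2
    rw [← h1, ← h2]
  · exact fun a _ => hV (measurableSet_singleton a)

end Mass

/-! ### Weights of blocks with independent letters. -/

section Block

variable {S T : Type*} [Fintype S]

/-- Marginal weight of the second component. -/
noncomputable def sndMarginal (P : S → T → ℝ) (t : T) : ℝ := ∑ s, P s t

/-- Conditional weight of the first component given the second. -/
noncomputable def condWeight (P : S → T → ℝ) (s : S) (t : T) : ℝ := P s t / sndMarginal P t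

/-- Weight of a pair of blocks whose letters are independent with joint weight `P`. -/
noncomputable def blockWeight (P : S → T → ℝ) {n : ℕ} (b : (Fin n → S) × (Fin n → T)) : ℝ :=
  ∏ i, P (b.1 i) (b.2 i)

theorem blockWeight_nonneg {S T : Type*} {P : S → T → ℝ} {n : ℕ} (hP : ∀ s t, 0 ≤ P s t) (b : (Fin n → S) × (Fin n → T)) : 0 ≤ blockWeight P b :=
  Finset.prod_nonneg fun _ _ => hP _ _

/-- Conditional weight of a block given the side-information block. -/
noncomputable def blockCondWeight (P : S → T → ℝ) {n : ℕ} (x : Fin n → S) (y : Fin n → T) : ℝ :=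
  ∏ i, condWeight P (x i) (y i)

variable {P : S → T → ℝ} {n : ℕ}

theorem sndMarginal_nonneg (hP : ∀ s t, 0 ≤ P s t) (t : T) : 0 ≤ sndMarginal P t := Finset.sum_nonneg fun s _ => hP s t

theorem condWeight_nonneg (hP : ∀ s t, 0 ≤ P s t) (s : S) (t : T) : 0 ≤ condWeight P s t :=
  div_nonneg (hP s t) (sndMarginal_nonneg hP t)

theorem condWeight_mul_sndMarginal (hP : ∀ s t, 0 ≤ P s t) (s : S) (t : T) :
    condWeight P s t * sndMarginal P t = P s t := by
  refine div_mul_cancel_of_imp fun h => ?_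
  exact (Finset.sum_eq_zero_iff_of_nonneg fun s _ => hP s t).1 h s (Finset.mem_univ s)

theorem blockCondWeight_nonneg (hP : ∀ s t, 0 ≤ P s t) (x : Fin n → S) (y : Fin n → T) : 0 ≤ blockCondWeight P x y :=
  Finset.prod_nonneg fun _ _ => condWeight_nonneg hP _ _

theorem blockWeight_eq_mul (hP : ∀ s t, 0 ≤ P s t) (b : (Fin n → S) × (Fin n → T)) :
    blockWeight P b = blockCondWeight P b.1 b.2 * ∏ i, sndMarginal P (b.2 i) := by
  simp only [blockWeight, blockCondWeight, ← Finset.prod_mul_distrib,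
    condWeight_mul_sndMarginal hP]

/-- Only an inequality: at a letter of zero marginal weight, division by zero makes all conditional
weights zero. -/
theorem sum_blockCondWeight_le (hP : ∀ s t, 0 ≤ P s t) (y : Fin n → T) : ∑ x, blockCondWeight P x y ≤ 1 := by
  classical
  have h := Finset.prod_univ_sum (fun _ : Fin n => (Finset.univ : Finset S))
    (fun i s => condWeight P s (y i))
  rw [Fintype.piFinset_univ] at h
  unfold blockCondWeight
  rw [← h]
  refine Finset.prod_le_one (fun i _ => Finset.sum_nonneg fun s _ => condWeight_nonneg hP _ _)
    fun i _ => ?_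
  simp only [condWeight, ← Finset.sum_div]
  exact div_self_le_one _

theorem sum_prod_sndMarginal [Fintype T] (h1 : ∑ t, sndMarginal P t = 1) :
    ∑ y : Fin n → T, ∏ i, sndMarginal P (y i) = 1 := by
  classical
  have h := Finset.prod_univ_sum (fun _ : Fin n => (Finset.univ : Finset T))
    (fun _ t => sndMarginal P t)
  rw [Fintype.piFinset_univ] at h
  rw [← h, h1, Finset.prod_const_one]

end Block

/-! ### Volume of Hamming balls. -/

section Ball

variable {S : Type*} [Fintype S] [DecidableEq S] {n : ℕ}

/-- Chernoff's method: each point of the ball contributes at least one to the sum of `s ^ (d - n *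
δ)`, `d` being its distance to `z`, and the sum of `s ^ d` over all points factors over coordinates.
-/
theorem card_hammingBall_le (z : Fin n → S) {s δ : ℝ} (hs : 0 < s) (hs1 : s ≤ 1) :
    ((Finset.univ.filter fun x : Fin n → S => (hammingDist x z : ℝ) ≤ n * δ).card : ℝ) ≤
      ((1 + Fintype.card S * s) * s ^ (-δ)) ^ n := by
  have hpow : ∀ x : Fin n → S, s ^ hammingDist x z = ∏ i, if x i ≠ z i then s else 1 := by
    intro x
    rw [← Finset.prod_filter, Finset.prod_const]
    rfl
  have hsum : ∑ x : Fin n → S, s ^ hammingDist x z ≤ (1 + Fintype.card S * s) ^ n := by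
    have h := Finset.prod_univ_sum (fun _ : Fin n => (Finset.univ : Finset S))
      (fun i a => if a ≠ z i then s else 1)
    rw [Fintype.piFinset_univ] at h
    simp only [hpow]
    rw [← h]
    calc ∏ i, ∑ a, (if a ≠ z i then s else 1) ≤ ∏ i : Fin n, (1 + Fintype.card S * s) := by
          refine Finset.prod_le_prod (fun i _ => Finset.sum_nonneg fun a _ => ?_) fun i _ => ?_
          · split_ifs <;> positivity
          · calc ∑ a, (if a ≠ z i then s else 1) ≤ ∑ a, ((if a = z i then 1 else 0) + s) := by
                  refine Finset.sum_le_sum fun a _ => ?_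
                  by_cases h : a = z i <;> simp [h, hs.le]
              _ = 1 + Fintype.card S * s := by
                  rw [Finset.sum_add_distrib]; simp
      _ = _ := by simp
  have hcard : ((Finset.univ.filter fun x : Fin n → S => (hammingDist x z : ℝ) ≤ n * δ).card : ℝ)
      ≤ ∑ x : Fin n → S, s ^ hammingDist x z * (s ^ (-δ)) ^ n := by
    rw [Finset.card_eq_sum_ones, Nat.cast_sum, Finset.sum_filter]
    refine Finset.sum_le_sum fun x _ => ?_
    split_ifs with hx
    · rw [← Real.rpow_natCast s, ← Real.rpow_natCast (s ^ (-δ)), ← Real.rpow_mul hs.le,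
        ← Real.rpow_add hs]
      push_cast
      exact Real.one_le_rpow_of_pos_of_le_one_of_nonpos hs hs1 (by nlinarith)
    · positivity
  refine hcard.trans ?_
  rw [← Finset.sum_mul, mul_pow]
  gcongr

end Ball


/-! ### Random binning and the counting bound. -/

section Binning

/-- Overwriting the value at `a` is reversible on colliding functions, since the lost value is still
stored at `b`. This is the bound `1 / m` on the collision probability of a uniformly random encoder.
-/
theorem card_collision_mul_le {α : Type*} [Fintype α] [DecidableEq α] (m : ℕ) {a b : α}
    (hab : a ≠ b) :
    (Finset.univ.filter fun f : α → Fin m => f a = f b).card * m ≤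
      Fintype.card (α → Fin m) := by
  have h := Finset.card_le_card_of_injOn
    (s := (Finset.univ.filter fun f : α → Fin m => f a = f b) ×ˢ (Finset.univ : Finset (Fin m)))
    (t := Finset.univ) (fun p => Function.update p.1 a p.2) (fun _ _ => Finset.mem_coe.2 (Finset.mem_univ _)) ?_
  · simpa [Finset.card_product] using h
  · rintro ⟨f, k⟩ hf ⟨f', k'⟩ hf' h
    simp only [Finset.coe_product, Set.mem_prod, Finset.mem_coe, Finset.mem_filter,
      Finset.mem_univ, true_and, and_true] at hf hf'
    have hne : ∀ x, x ≠ a → f x = f' x := fun x hx => by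
      simpa [Function.update_of_ne hx] using congrFun h x
    refine Prod.ext (funext fun x => ?_) (by simpa using congrFun h a)
    by_cases hx : x = a
    · subst hx
      change f x = f' x
      rw [hf, hf', hne b hab.symm]
    · exact hne x hx

variable {S T : Type*} [Fintype S] [Fintype T] {P : S → T → ℝ} {n : ℕ}

theorem sum_blockWeight_le (hP : ∀ s t, 0 ≤ P s t) (h1 : ∑ t, sndMarginal P t = 1) :
    ∑ b : (Fin n → S) × (Fin n → T), blockWeight P b ≤ 1 := by
  rw [Fintype.sum_prod_type_right]
  calc ∑ y : Fin n → T, ∑ x : Fin n → S, blockWeight P (x, y)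
      = ∑ y : Fin n → T, (∑ x, blockCondWeight P x y) * ∏ i, sndMarginal P (y i) := by
        simp only [blockWeight_eq_mul hP, Finset.sum_mul]
    _ ≤ ∑ y : Fin n → T, 1 * ∏ i, sndMarginal P (y i) := by
        refine Finset.sum_le_sum fun y _ => mul_le_mul_of_nonneg_right
          (sum_blockCondWeight_le hP y) (Finset.prod_nonneg fun i _ => sndMarginal_nonneg hP _)
    _ = 1 := by simp only [one_mul, sum_prod_sndMarginal h1]

/-- Blocks sharing their bin under `f` with another block of conditional weight at least `θ`. -/
def collisionSet (P : S → T → ℝ) {m : ℕ} (θ : ℝ) (f : (Fin n → S) → Fin m) :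
    Set ((Fin n → S) × (Fin n → T)) :=
  {b | ∃ x, x ≠ b.1 ∧ f x = f b.1 ∧ θ ≤ blockCondWeight P x b.2}

/-- First-moment bound over all encoders: the indicator of a competitor above the threshold is at
most its conditional weight over `θ`, these sum to at most `1 / θ`, and each competitor collides
with probability at most `1 / m`. -/
theorem sum_mass_collisionSet_le (hP : ∀ s t, 0 ≤ P s t) (h1 : ∑ t, sndMarginal P t = 1)
    {θ : ℝ} (hθ : 0 < θ) {m : ℕ} (hm : 0 < m) [DecidableEq S] :
    ∑ f : (Fin n → S) → Fin m, mass (blockWeight P) (collisionSet P θ f) ≤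
      (Fintype.card ((Fin n → S) → Fin m) : ℝ) * (1 / (θ * m)) := by
  classical
  set N : ℝ := ((Fintype.card ((Fin n → S) → Fin m) : ℕ) : ℝ) with hN
  have hm' : (0 : ℝ) < m := by exact_mod_cast hm
  have hpt : ∀ (f : (Fin n → S) → Fin m) (b : (Fin n → S) × (Fin n → T)),
      (collisionSet P θ f).indicator (blockWeight P) b ≤
        blockWeight P b * ∑ x, if x ≠ b.1 ∧ f x = f b.1 then blockCondWeight P x b.2 / θ else 0 := by
    intro f b
    have hterm : ∀ x, 0 ≤ if x ≠ b.1 ∧ f x = f b.1 then blockCondWeight P x b.2 / θ else 0 := by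
      intro x
      split_ifs
      · exact div_nonneg (blockCondWeight_nonneg hP _ _) hθ.le
      · exact le_rfl
    by_cases hb : b ∈ collisionSet P θ f
    · rw [Set.indicator_of_mem hb]
      obtain ⟨x, hx, hf, hc⟩ := hb
      refine le_mul_of_one_le_right (blockWeight_nonneg hP b) ?_
      refine le_trans ?_ (Finset.single_le_sum (fun x _ => hterm x) (Finset.mem_univ x))
      rw [if_pos ⟨hx, hf⟩]
      exact (one_le_div hθ).2 hc
    · rw [Set.indicator_of_notMem hb]
      exact mul_nonneg (blockWeight_nonneg hP b) (Finset.sum_nonneg fun x _ => hterm x)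
  have hcol : ∀ x x' : Fin n → S, ∀ v : ℝ, 0 ≤ v →
      ∑ f : (Fin n → S) → Fin m, (if x ≠ x' ∧ f x = f x' then v else 0) ≤ v * (N / m) := by
    intro x x' v hv
    by_cases hx : x = x'
    · simp only [hx, ne_eq, not_true_eq_false, false_and, if_false, Finset.sum_const_zero]
      positivity
    · simp only [ne_eq, hx, not_false_eq_true, true_and]
      rw [← Finset.sum_filter, Finset.sum_const, nsmul_eq_mul, mul_comm]
      refine mul_le_mul_of_nonneg_left ?_ hv
      rw [le_div_iff₀ hm']
      have h := card_collision_mul_le m hx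
      rw [hN]
      convert (Nat.cast_le (α := ℝ)).2 h using 1
      push_cast
      rfl
  calc ∑ f : (Fin n → S) → Fin m, mass (blockWeight P) (collisionSet P θ f)
      ≤ ∑ f : (Fin n → S) → Fin m, ∑ b, blockWeight P b *
          ∑ x, if x ≠ b.1 ∧ f x = f b.1 then blockCondWeight P x b.2 / θ else 0 :=
        Finset.sum_le_sum fun f _ => Finset.sum_le_sum fun b _ => hpt f b
    _ = ∑ b, blockWeight P b * ∑ x, ∑ f : (Fin n → S) → Fin m,
          if x ≠ b.1 ∧ f x = f b.1 then blockCondWeight P x b.2 / θ else 0 := by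
        rw [Finset.sum_comm]
        refine Finset.sum_congr rfl fun b _ => ?_
        rw [← Finset.mul_sum, Finset.sum_comm]
    _ ≤ ∑ b : (Fin n → S) × (Fin n → T), blockWeight P b * (1 / θ * (N / m)) := by
        refine Finset.sum_le_sum fun b _ => mul_le_mul_of_nonneg_left ?_ (blockWeight_nonneg hP b)
        calc _ ≤ ∑ x, blockCondWeight P x b.2 / θ * (N / m) := Finset.sum_le_sum fun x _ =>
              hcol x b.1 _ (div_nonneg (blockCondWeight_nonneg hP _ _) hθ.le)
          _ ≤ _ := by
              rw [← Finset.sum_mul, ← Finset.sum_div]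
              have := sum_blockCondWeight_le hP b.2
              gcongr
    _ ≤ 1 * (1 / θ * (N / m)) := by
        rw [← Finset.sum_mul]
        exact mul_le_mul_of_nonneg_right (sum_blockWeight_le hP h1) (by positivity)
    _ = N * (1 / (θ * m)) := by
        field_simp

/-- Random binning: some encoder into `m` bins allows to recover `x` from its bin and `y`, unless
the conditional weight of `x` given `y` is small, up to an error `1 / (θ m)`. -/
theorem exists_binning [Nonempty S] (hP : ∀ s t, 0 ≤ P s t) (h1 : ∑ t, sndMarginal P t = 1)
    {θ : ℝ} (hθ : 0 < θ) {m : ℕ} (hm : 0 < m) :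
    ∃ (f : (Fin n → S) → Fin m) (g : Fin m → (Fin n → T) → (Fin n → S)),
      mass (blockWeight P) {b | g (f b.1) b.2 ≠ b.1} ≤
        mass (blockWeight P) {b : (Fin n → S) × (Fin n → T) | blockCondWeight P b.1 b.2 < θ} +
          1 / (θ * m) := by
  classical
  have : Nonempty (Fin m) := ⟨⟨0, hm⟩⟩
  obtain ⟨f, -, hf⟩ := Finset.exists_le_of_sum_le (s := (Finset.univ : Finset ((Fin n → S) → Fin m)))
    (f := fun f => mass (blockWeight P) (collisionSet P θ f)) (g := fun _ => 1 / (θ * m))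
    Finset.univ_nonempty (by
      rw [Finset.sum_const, nsmul_eq_mul]
      exact sum_mass_collisionSet_le hP h1 hθ hm)
  -- The decoder picks any block in the bin above the threshold; it errs only if the true block is
  -- below it or has a competitor.
  refine ⟨f, fun k y => Classical.epsilon fun x => f x = k ∧ θ ≤ blockCondWeight P x y, ?_⟩
  refine le_trans (mass_mono (blockWeight_nonneg hP) fun b hb => ?_)
    ((mass_union_le (blockWeight_nonneg hP) _ _).trans (add_le_add le_rfl hf))
  by_cases ht : blockCondWeight P b.1 b.2 < θ
  · exact Or.inl ht
  · have h := Classical.epsilon_spec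
      (p := fun x => f x = f b.1 ∧ θ ≤ blockCondWeight P x b.2) ⟨b.1, rfl, not_lt.1 ht⟩
    exact Or.inr ⟨_, hb, h.1, h.2⟩

/-- Counting bound: few pairs of blocks have small conditional weight and are approximately
recovered from one of `m` messages. -/
theorem mass_ball_le (hP : ∀ s t, 0 ≤ P s t) (h1 : ∑ t, sndMarginal P t = 1) {m : ℕ}
    (f : (Fin n → S) → Fin m) (z : Fin m → (Fin n → T) → Set (Fin n → S)) {θ N : ℝ} (hθ : 0 ≤ θ)
    (hN : ∀ k y, ((z k y).ncard : ℝ) ≤ N) :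
    mass (blockWeight P) {b | b.1 ∈ z (f b.1) b.2 ∧ blockCondWeight P b.1 b.2 ≤ θ} ≤
      m * N * θ := by
  classical
  have hpt : ∀ x y, ({b : (Fin n → S) × (Fin n → T) |
      b.1 ∈ z (f b.1) b.2 ∧ blockCondWeight P b.1 b.2 ≤ θ}).indicator (blockWeight P) (x, y) ≤
      ∑ k, (if x ∈ z k y then θ * ∏ i, sndMarginal P (y i) else 0) := by
    intro x y
    have hM : 0 ≤ ∏ i, sndMarginal P (y i) :=
      Finset.prod_nonneg fun i _ => sndMarginal_nonneg hP _
    have hterm : ∀ k, 0 ≤ (if x ∈ z k y then θ * ∏ i, sndMarginal P (y i) else 0) := by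
      intro k
      split_ifs <;> positivity
    by_cases hb : x ∈ z (f x) y ∧ blockCondWeight P x y ≤ θ
    · rw [Set.indicator_of_mem (by exact hb), blockWeight_eq_mul hP]
      refine le_trans ?_ (Finset.single_le_sum (fun k _ => hterm k) (Finset.mem_univ (f x)))
      rw [if_pos hb.1]
      exact mul_le_mul_of_nonneg_right hb.2 hM
    · rw [Set.indicator_of_notMem (by exact hb)]
      exact Finset.sum_nonneg fun k _ => hterm k
  unfold mass
  rw [Fintype.sum_prod_type_right]
  calc _ ≤ ∑ y : Fin n → T, ∑ x : Fin n → S, ∑ k,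
        (if x ∈ z k y then θ * ∏ i, sndMarginal P (y i) else 0) :=
        Finset.sum_le_sum fun y _ => Finset.sum_le_sum fun x _ => hpt x y
    _ = ∑ y : Fin n → T, ∑ k, ((z k y).ncard : ℝ) * (θ * ∏ i, sndMarginal P (y i)) := by
        refine Finset.sum_congr rfl fun y _ => ?_
        rw [Finset.sum_comm]
        refine Finset.sum_congr rfl fun k _ => ?_
        rw [← Finset.sum_filter, Finset.sum_const, nsmul_eq_mul, Set.ncard_eq_toFinset_card']
        congr 3
        ext x
        simp
    _ ≤ ∑ y : Fin n → T, ∑ k : Fin m, N * (θ * ∏ i, sndMarginal P (y i)) := by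
        refine Finset.sum_le_sum fun y _ => Finset.sum_le_sum fun k _ => ?_
        exact mul_le_mul_of_nonneg_right (hN k y)
          (mul_nonneg hθ (Finset.prod_nonneg fun i _ => sndMarginal_nonneg hP _))
    _ = m * N * θ := by
        simp only [Finset.sum_const, Finset.card_univ, Fintype.card_fin, nsmul_eq_mul,
          ← Finset.mul_sum, sum_prod_sndMarginal h1]
        ring

end Binning

/-! ### Source letters read off from a decoder for `φ`. -/

section Estimator

variable {S T V : Type*} [Fintype S] [Fintype T] [DecidableEq T] {P : S → T → ℝ} {n : ℕ}

/-- Updating forgets only `y i`, so it is at most `Fintype.card T` to one. -/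
theorem sum_update_le {F : (Fin n → T) → ℝ} (hF : ∀ y, 0 ≤ F y) (i : Fin n) (t : T) :
    ∑ y, F (Function.update y i t) ≤ Fintype.card T * ∑ y, F y := by
  classical
  have hinj : Function.Injective fun y : Fin n → T => (Function.update y i t, y i) := by
    intro y y' h
    simp only [Prod.mk.injEq] at h
    calc y = Function.update (Function.update y i t) i (y i) := by simp
      _ = Function.update (Function.update y' i t) i (y' i) := by rw [h.1, h.2]
      _ = y' := by simp
  calc ∑ y, F (Function.update y i t)
      = ∑ p ∈ Finset.univ.image fun y : Fin n → T => (Function.update y i t, y i), F p.1 := by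
        rw [Finset.sum_image fun a _ b _ h => hinj h]
    _ ≤ ∑ p : (Fin n → T) × T, F p.1 :=
        Finset.sum_le_sum_of_subset_of_nonneg (Finset.subset_univ _) fun p _ _ => hF _
    _ = Fintype.card T * ∑ y, F y := by
        rw [Fintype.sum_prod_type]
        simp [Finset.mul_sum]

theorem blockWeight_le_mul_update {S T : Type*} {P : S → T → ℝ} {n : ℕ}
    (hP : ∀ s t, 0 ≤ P s t) {D : ℝ}
    (hD : ∀ s t t', P s t ≤ D * P s t') (x : Fin n → S) (y : Fin n → T) (i : Fin n) (t : T) :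
    blockWeight P (x, y) ≤ D * blockWeight P (x, Function.update y i t) := by
  classical
  unfold blockWeight
  rw [← Finset.mul_prod_erase _ _ (Finset.mem_univ i), ← Finset.mul_prod_erase _ _ (Finset.mem_univ i),
    ← mul_assoc]
  refine mul_le_mul ?_ (le_of_eq ?_) (Finset.prod_nonneg fun _ _ => hP _ _)
    ((hP (x i) t).trans (hD _ _ _))
  · simpa using hD _ _ _
  · refine Finset.prod_congr rfl fun j hj => ?_
    simp [Function.update_of_ne (Finset.ne_of_mem_erase hj)]

theorem mass_update_le (hP : ∀ s t, 0 ≤ P s t) {D : ℝ} (hD0 : 0 ≤ D)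
    (hD : ∀ s t t', P s t ≤ D * P s t') (E : Set ((Fin n → S) × (Fin n → T)))
    (i : Fin n) (t : T) :
    mass (blockWeight P) {b | (b.1, Function.update b.2 i t) ∈ E} ≤
      D * Fintype.card T * mass (blockWeight P) E := by
  unfold mass
  rw [Fintype.sum_prod_type, Fintype.sum_prod_type, Finset.mul_sum]
  refine Finset.sum_le_sum fun x _ => ?_
  have hnn : ∀ y, 0 ≤ E.indicator (blockWeight P) (x, y) := fun y =>
    Set.indicator_nonneg (fun b _ => blockWeight_nonneg hP b) _
  calc _ ≤ ∑ y : Fin n → T, D * E.indicator (blockWeight P) (x, Function.update y i t) := by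
        refine Finset.sum_le_sum fun y _ => ?_
        by_cases h : (x, Function.update y i t) ∈ E
        · rw [Set.indicator_of_mem (by exact h), Set.indicator_of_mem h]
          exact blockWeight_le_mul_update hP hD x y i t
        · rw [Set.indicator_of_notMem (by exact h)]
          exact mul_nonneg hD0 (hnn _)
    _ ≤ _ := by
        rw [← Finset.mul_sum, mul_assoc]
        exact mul_le_mul_of_nonneg_left (sum_update_le hnn i t) hD0

/-- The estimate of the `i`-th source letter obtained by feeding the decoder every value of the
`i`-th side-information letter. -/
noncomputable def letterEstimate [Nonempty S] (φ : S → T → V) {m : ℕ}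
    (g : Fin m → (Fin n → T) → (Fin n → V)) (k : Fin m) (y : Fin n → T) (i : Fin n) : S :=
  Classical.epsilon fun s => ∀ t, φ s t = g k (Function.update y i t) i

/-- A wrong estimate forces a decoding error for some modification of the `i`-th side letter. One
factor `Fintype.card T` comes from the union over modifications, the other from the multiplicity of
the update map; `D` is the change of measure. -/
theorem mass_letterEstimate_ne_le [Nonempty S] (hP : ∀ s t, 0 ≤ P s t) {D : ℝ} (hD0 : 0 ≤ D)
    (hD : ∀ s t t', P s t ≤ D * P s t') {φ : S → T → V}
    (hφ : ∀ s s' t, P s t ≠ 0 → (∀ t, φ s t = φ s' t) → s' = s) {m : ℕ}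
    (f : (Fin n → S) → Fin m) (g : Fin m → (Fin n → T) → (Fin n → V)) (i : Fin n) :
    mass (blockWeight P) {b | letterEstimate φ g (f b.1) b.2 i ≠ b.1 i} ≤
      D * (Fintype.card T : ℝ) ^ 2 *
        mass (blockWeight P) {b | g (f b.1) b.2 ≠ fun i => φ (b.1 i) (b.2 i)} := by
  set E : Set ((Fin n → S) × (Fin n → T)) := {b | g (f b.1) b.2 ≠ fun i => φ (b.1 i) (b.2 i)}
  calc _ ≤ mass (blockWeight P) (⋃ t, {b | (b.1, Function.update b.2 i t) ∈ E}) := by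
        refine mass_mono_of_ne_zero (blockWeight_nonneg hP) fun b hb hne => ?_
        by_contra hcon
        simp only [Set.mem_iUnion, Set.mem_ofPred_eq, not_exists, E, ne_eq, not_not] at hcon
        have hcon' : ∀ t, φ (b.1 i) t = g (f b.1) (Function.update b.2 i t) i := fun t => by
          simpa using (congrFun (hcon t) i).symm
        have h := Classical.epsilon_spec
          (p := fun s => ∀ t, φ s t = g (f b.1) (Function.update b.2 i t) i) ⟨b.1 i, hcon'⟩
        refine hne (hφ _ _ (b.2 i) ?_ fun t => (hcon' t).trans (h t).symm)
        exact Finset.prod_ne_zero_iff.1 hb i (Finset.mem_univ i)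
    _ ≤ ∑ t : T, D * Fintype.card T * mass (blockWeight P) E :=
        (mass_iUnion_le (blockWeight_nonneg hP) _).trans
          (Finset.sum_le_sum fun t _ => mass_update_le hP hD0 hD E i t)
    _ = _ := by
        rw [Finset.sum_const, Finset.card_univ, nsmul_eq_mul]
        ring

/-- Linearity of expectation over the letters, then Markov; the factor `n` cancels, so the bound
does not depend on the block length. -/
theorem mass_hammingDist_letterEstimate_le [Nonempty S] [DecidableEq S]
    (hP : ∀ s t, 0 ≤ P s t) {D : ℝ} (hD0 : 0 ≤ D)
    (hD : ∀ s t t', P s t ≤ D * P s t') {φ : S → T → V}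
    (hφ : ∀ s s' t, P s t ≠ 0 → (∀ t, φ s t = φ s' t) → s' = s) {m : ℕ}
    (f : (Fin n → S) → Fin m) (g : Fin m → (Fin n → T) → (Fin n → V)) (hn : 0 < n)
    {δ : ℝ} (hδ : 0 < δ) :
    mass (blockWeight P)
        {b | n * δ ≤ (hammingDist b.1 (letterEstimate φ g (f b.1) b.2) : ℝ)} ≤
      D * (Fintype.card T : ℝ) ^ 2 / δ *
        mass (blockWeight P) {b | g (f b.1) b.2 ≠ fun i => φ (b.1 i) (b.2 i)} := by
  set e := mass (blockWeight P) {b : (Fin n → S) × (Fin n → T) |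
    g (f b.1) b.2 ≠ fun i => φ (b.1 i) (b.2 i)} with he
  have hn' : (0 : ℝ) < n := by exact_mod_cast hn
  have hM := mul_mass_le_sum (w := blockWeight P) (blockWeight_nonneg hP)
    (d := fun b : (Fin n → S) × (Fin n → T) =>
      (hammingDist b.1 (letterEstimate φ g (f b.1) b.2) : ℝ)) (fun b => Nat.cast_nonneg _) (n * δ)
  have hsum : ∑ b : (Fin n → S) × (Fin n → T), blockWeight P b *
      (hammingDist b.1 (letterEstimate φ g (f b.1) b.2) : ℝ) ≤
      n * (D * (Fintype.card T : ℝ) ^ 2 * e) := by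
    calc _ = ∑ i, mass (blockWeight P) {b | letterEstimate φ g (f b.1) b.2 i ≠ b.1 i} := by
          unfold mass
          rw [Finset.sum_comm]
          refine Finset.sum_congr rfl fun b _ => ?_
          rw [hammingDist, Finset.card_eq_sum_ones, Nat.cast_sum, Finset.sum_filter,
            Finset.mul_sum]
          refine Finset.sum_congr rfl fun i _ => ?_
          by_cases h : letterEstimate φ g (f b.1) b.2 i = b.1 i
          · simp [h]
          · simp [h, Ne.symm h]
      _ ≤ ∑ i : Fin n, D * (Fintype.card T : ℝ) ^ 2 * e :=
          Finset.sum_le_sum fun i _ => mass_letterEstimate_ne_le hP hD0 hD hφ f g i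
      _ = _ := by simp
  have h := hM.trans hsum
  rw [mul_assoc] at h
  have h' := le_of_mul_le_mul_left h hn'
  rw [div_mul_eq_mul_div, le_div_iff₀ hδ, mul_comm]
  exact h'

end Estimator


/-- Joint weights of a pair of finite-valued random variables. -/
def jointWeight {Ω S T : Type*} [MeasurableSpace Ω] (μ : Measure Ω) (X : Ω → S) (Y : Ω → T)
    (s : S) (t : T) : ℝ := μ.real {ω | X ω = s ∧ Y ω = t}

/-- Conditional self-information, in bits. -/
noncomputable def condInfo {S T : Type*} [Fintype S] (P : S → T → ℝ) (s : S) (t : T) : ℝ :=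
  -Real.logb 2 (condWeight P s t)

/-- Pairs of blocks whose conditional self-information deviates from `n * h` by at least `n * γ`. -/
def atypicalSet {S T : Type*} [Fintype S] (P : S → T → ℝ) (h γ : ℝ) (n : ℕ) :
    Set ((Fin n → S) × (Fin n → T)) :=
  {b | n * γ ≤ |∑ i, condInfo P (b.1 i) (b.2 i) - n * h|}

/-! ### Conditional self-information and typicality. -/

section Weights

variable {S T : Type*} [Fintype S] {P : S → T → ℝ} {n : ℕ}

theorem condWeight_le_one (hP : ∀ s t, 0 ≤ P s t) (s : S) (t : T) : condWeight P s t ≤ 1 :=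
  div_le_one_of_le₀ (Finset.single_le_sum (fun s _ => hP s t) (Finset.mem_univ s))
    (sndMarginal_nonneg hP t)

theorem condInfo_nonneg (hP : ∀ s t, 0 ≤ P s t) (s : S) (t : T) : 0 ≤ condInfo P s t :=
  neg_nonneg.2 (Real.logb_nonpos one_lt_two (condWeight_nonneg hP s t) (condWeight_le_one hP s t))

/-- The support hypothesis matters: `Real.logb 2 0 = 0` would turn a zero weight into `1`. -/
theorem blockCondWeight_eq_rpow (hP : ∀ s t, 0 ≤ P s t) {b : (Fin n → S) × (Fin n → T)}
    (hb : blockWeight P b ≠ 0) :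
    blockCondWeight P b.1 b.2 = 2 ^ (-∑ i, condInfo P (b.1 i) (b.2 i)) := by
  rw [← Finset.sum_neg_distrib, Real.rpow_sum_of_pos two_pos]
  refine Finset.prod_congr rfl fun i _ => ?_
  have hi : P (b.1 i) (b.2 i) ≠ 0 := Finset.prod_ne_zero_iff.1 hb i (Finset.mem_univ i)
  have hc : 0 < condWeight P (b.1 i) (b.2 i) := by
    refine (condWeight_nonneg hP _ _).lt_of_ne fun h => hi ?_
    rw [← condWeight_mul_sndMarginal hP, ← h, zero_mul]
  rw [condInfo, neg_neg, Real.rpow_logb two_pos (by norm_num) hc]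

theorem mem_atypicalSet_of_lt (hP : ∀ s t, 0 ≤ P s t) {h γ : ℝ}
    {b : (Fin n → S) × (Fin n → T)} (hb : blockWeight P b ≠ 0)
    (hlt : blockCondWeight P b.1 b.2 < 2 ^ (-(n * (h + γ)))) : b ∈ atypicalSet P h γ n := by
  rw [blockCondWeight_eq_rpow hP hb, Real.rpow_lt_rpow_left_iff one_lt_two] at hlt
  have h' : n * γ ≤ ∑ i, condInfo P (b.1 i) (b.2 i) - n * h := by linarith
  exact h'.trans (le_abs_self _)

theorem mem_atypicalSet_of_gt (hP : ∀ s t, 0 ≤ P s t) {h γ : ℝ}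
    {b : (Fin n → S) × (Fin n → T)} (hb : blockWeight P b ≠ 0)
    (hlt : 2 ^ (-(n * (h - γ))) < blockCondWeight P b.1 b.2) : b ∈ atypicalSet P h γ n := by
  rw [blockCondWeight_eq_rpow hP hb, Real.rpow_lt_rpow_left_iff one_lt_two] at hlt
  have h' : n * γ ≤ -(∑ i, condInfo P (b.1 i) (b.2 i) - n * h) := by linarith
  exact h'.trans (neg_le_abs _)

end Weights

/-! ### Coding theorem for memoryless pairs. -/

section Memoryless

variable {Ω S T V : Type*} [MeasurableSpace Ω] [Fintype S] [Fintype T]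
  [MeasurableSpace S] [MeasurableSingletonClass S] [MeasurableSpace T] [MeasurableSingletonClass T]
  {μ : Measure Ω} [IsProbabilityMeasure μ] {X : ℕ → Ω → S} {Y : ℕ → Ω → T}

theorem measureReal_block (hW : IsMemoryless μ fun i ω => (X i ω, Y i ω)) {n : ℕ}
    (E : Set ((Fin n → S) × (Fin n → T))) :
    μ.real {ω | ((fun i : Fin n => X i ω), (fun i : Fin n => Y i ω)) ∈ E} =
      mass (blockWeight (jointWeight μ (X 0) (Y 0))) E := by
  have hX : ∀ i, Measurable (X i) := fun i => measurable_fst.comp (hW.measurable i)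
  have hY : ∀ i, Measurable (Y i) := fun i => measurable_snd.comp (hW.measurable i)
  have hV : Measurable fun ω => ((fun i : Fin n => X i ω), (fun i : Fin n => Y i ω)) :=
    (measurable_pi_lambda (fun ω (i : Fin n) => X i ω) fun i => hX i).prodMk
      (measurable_pi_lambda (fun ω (i : Fin n) => Y i ω) fun i => hY i)
  refine (measureReal_preimage_eq_mass μ hV E).trans ?_
  congr 1
  funext b
  have hind := (hW.indep.precomp (g := fun i : Fin n => (i : ℕ))
    Fin.val_injective).measure_inter_preimage_eq_mul Finset.univ
    (sets := fun i => {(b.1 i, b.2 i)}) fun i _ => measurableSet_singleton _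
  have hset : (fun ω => ((fun i : Fin n => X i ω), (fun i : Fin n => Y i ω))) ⁻¹' {b} =
      ⋂ i ∈ (Finset.univ : Finset (Fin n)),
        (fun ω => (X i ω, Y i ω)) ⁻¹' {(b.1 i, b.2 i)} := by
    ext ω
    simp [Prod.ext_iff, funext_iff, forall_and]
  rw [hset, measureReal_def, hind, ENNReal.toReal_prod]
  refine Finset.prod_congr rfl fun i _ => ?_
  rw [(hW.identDistrib i).measure_preimage_eq (measurableSet_singleton _)]
  simp only [jointWeight, measureReal_def]
  congr 2
  ext ω
  simp

theorem errorProb_eq_mass (hW : IsMemoryless μ fun i ω => (X i ω, Y i ω)) (φ : S → T → V)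
    {n m : ℕ} (f : (Fin n → S) → Fin m) (g : Fin m → (Fin n → T) → (Fin n → V)) :
    errorProb μ X Y φ f g = mass (blockWeight (jointWeight μ (X 0) (Y 0)))
      {b | g (f b.1) b.2 ≠ fun i => φ (b.1 i) (b.2 i)} :=
  measureReal_block hW {b | g (f b.1) b.2 ≠ fun i => φ (b.1 i) (b.2 i)}

omit [Fintype T] in
theorem sndMarginal_jointWeight {X : Ω → S} {Y : Ω → T} (hX : Measurable X) (hY : Measurable Y)
    (t : T) : sndMarginal (jointWeight μ X Y) t = μ.real {ω | Y ω = t} := by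
  have h : {ω | Y ω = t} = ⋃ s ∈ (Finset.univ : Finset S), {ω | X ω = s ∧ Y ω = t} := by
    ext ω; simp
  rw [h, measureReal_biUnion_finset]
  · rfl
  · intro a _ b _ hab
    exact Set.disjoint_left.2 fun ω h1 h2 => hab (h1.1.symm.trans h2.1)
  · exact fun s _ => (hX (measurableSet_singleton s)).inter (hY (measurableSet_singleton t))

omit [Fintype T] [MeasurableSpace T] [MeasurableSingletonClass T] in
theorem sum_measureReal_eq_one {V : Ω → S} (hV : Measurable V) :
    ∑ s, μ.real {ω | V ω = s} = 1 := by
  have h := measureReal_preimage_eq_mass μ hV Set.univ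
  rw [mass_univ] at h
  simpa [Set.preimage] using h.symm

theorem sum_sndMarginal_jointWeight {X : Ω → S} {Y : Ω → T} (hX : Measurable X)
    (hY : Measurable Y) : ∑ t, sndMarginal (jointWeight μ X Y) t = 1 := by
  simpa only [sndMarginal_jointWeight hX hY] using sum_measureReal_eq_one hY

theorem condEntropy_eq_sum {X : Ω → S} {Y : Ω → T} (hX : Measurable X) (hY : Measurable Y) :
    condEntropy μ X Y =
      ∑ t, ∑ s, jointWeight μ X Y s t * condInfo (jointWeight μ X Y) s t := by
  simp only [condEntropy, condInfo, condWeight, sndMarginal_jointWeight hX hY, mul_neg,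
    Finset.sum_neg_distrib]
  rfl

/-- Asymptotic equipartition: the strong law for the self-informations, whose mean is the
conditional entropy, weakened to convergence in measure. -/
theorem tendsto_mass_atypicalSet (hW : IsMemoryless μ fun i ω => (X i ω, Y i ω)) {γ : ℝ}
    (hγ : 0 < γ) :
    Tendsto (fun n => mass (blockWeight (jointWeight μ (X 0) (Y 0)))
      (atypicalSet (jointWeight μ (X 0) (Y 0)) (condEntropy μ (X 0) (Y 0)) γ n))
      atTop (nhds 0) := by
  set P := jointWeight μ (X 0) (Y 0) with hPdef
  have hX : Measurable (X 0) := measurable_fst.comp (hW.measurable 0)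
  have hY : Measurable (Y 0) := measurable_snd.comp (hW.measurable 0)
  set G : S × T → ℝ := fun p => condInfo P p.1 p.2 with hG
  have hGm : Measurable G := Measurable.of_discrete
  have hint : Integrable G (μ.map fun ω => (X 0 ω, Y 0 ω)) := by
    have := Measure.isProbabilityMeasure_map (μ := μ) (hW.measurable 0).aemeasurable
    exact Integrable.of_finite
  have hmean : ∫ ω, G (X 0 ω, Y 0 ω) ∂μ = condEntropy μ (X 0) (Y 0) := by
    rw [← integral_map (φ := fun ω => (X 0 ω, Y 0 ω)) (hW.measurable 0).aemeasurable
      hGm.aestronglyMeasurable, integral_fintype hint, Fintype.sum_prod_type_right,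
      condEntropy_eq_sum hX hY]
    refine Finset.sum_congr rfl fun t _ => Finset.sum_congr rfl fun s _ => ?_
    rw [map_measureReal_apply (hW.measurable 0) (measurableSet_singleton _), smul_eq_mul]
    congr 1
    simp only [jointWeight]
    congr 1
    ext ω
    simp
  have hsl := strong_law_ae_real (μ := μ) (fun i ω => G (X i ω, Y i ω))
    (hint.comp_measurable (hW.measurable 0))
    (fun i j hij => (hW.indep.indepFun hij).comp hGm hGm)
    (fun i => (hW.identDistrib i).comp hGm)
  rw [hmean] at hsl
  have hmeas := tendstoInMeasure_of_tendsto_ae (fun n => by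
    refine (Measurable.div_const (Finset.measurable_sum _ fun i _ =>
      hGm.comp (hW.measurable i)) _).aestronglyMeasurable) hsl
  have ht := tendstoInMeasure_iff_measureReal_norm.1 hmeas γ hγ
  refine ht.congr' ?_
  filter_upwards [eventually_gt_atTop 0] with n hn
  have hn' : (0 : ℝ) < n := by exact_mod_cast hn
  rw [← measureReal_block hW]
  congr 1
  ext ω
  simp only [atypicalSet, Set.mem_ofPred_eq, Real.norm_eq_abs]
  rw [Finset.sum_range fun i => G (X i ω, Y i ω)]
  have : (∑ i : Fin n, G (X i ω, Y i ω)) / n - condEntropy μ (X 0) (Y 0) =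
      (∑ i : Fin n, G (X i ω, Y i ω) - n * condEntropy μ (X 0) (Y 0)) / n := by
    field_simp
  rw [this, abs_div, abs_of_pos hn', le_div_iff₀ hn', mul_comm]

theorem tendsto_two_rpow_neg_mul {c : ℝ} (hc : 0 < c) :
    Tendsto (fun n : ℕ => (2 : ℝ) ^ (-(n * c))) atTop (nhds 0) := by
  have h := tendsto_pow_atTop_nhds_zero_of_lt_one (r := (2 : ℝ) ^ (-c)) (by positivity)
    (Real.rpow_lt_one_of_one_lt_of_neg one_lt_two (neg_lt_zero.2 hc))
  refine h.congr fun n => ?_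
  rw [← Real.rpow_natCast, ← Real.rpow_mul two_pos.le]
  congr 1
  ring

theorem achievable_of_condEntropy_lt [Nonempty S] (hW : IsMemoryless μ fun i ω => (X i ω, Y i ω))
    (φ : S → T → V) {R : ℝ} (hR : condEntropy μ (X 0) (Y 0) < R) : Achievable μ X Y φ R := by
  intro ε hε
  have hX : Measurable (X 0) := measurable_fst.comp (hW.measurable 0)
  have hY : Measurable (Y 0) := measurable_snd.comp (hW.measurable 0)
  set P := jointWeight μ (X 0) (Y 0) with hPdef
  set H := condEntropy μ (X 0) (Y 0) with hH
  have hP : ∀ s t, 0 ≤ P s t := fun s t => measureReal_nonneg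
  have h1 : ∑ t, sndMarginal P t = 1 := sum_sndMarginal_jointWeight hX hY
  have hH0 : 0 ≤ H := by
    rw [hH, condEntropy_eq_sum hX hY]
    exact Finset.sum_nonneg fun t _ => Finset.sum_nonneg fun s _ =>
      mul_nonneg (hP s t) (condInfo_nonneg hP s t)
  -- Thus `R = H + 2 * γ`: one `γ` goes to the typicality threshold, the other makes the collision
  -- term decay.
  obtain ⟨γ, hγ⟩ : ∃ γ, γ = (R - H) / 2 := ⟨_, rfl⟩
  have hγ0 : 0 < γ := by linarith
  have hA := (tendsto_mass_atypicalSet hW hγ0).eventually (gt_mem_nhds (half_pos hε))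
  have hB := ((tendsto_two_rpow_neg_mul hγ0).const_mul 2).eventually
    (gt_mem_nhds (show 2 * (0 : ℝ) < ε / 2 by linarith))
  filter_upwards [hA, hB] with n hAn hBn
  have hpow : (1 : ℝ) ≤ 2 ^ ((n : ℝ) * R) :=
    Real.one_le_rpow one_le_two (mul_nonneg n.cast_nonneg (by linarith))
  set m := ⌊(2 : ℝ) ^ ((n : ℝ) * R)⌋₊ with hm
  have hm0 : 0 < m := Nat.floor_pos.2 hpow
  have hmle : (m : ℝ) ≤ 2 ^ ((n : ℝ) * R) := Nat.floor_le (by positivity)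
  have hmge : (2 : ℝ) ^ ((n : ℝ) * R) ≤ 2 * m := by
    have h := Nat.lt_floor_add_one ((2 : ℝ) ^ ((n : ℝ) * R))
    have : (1 : ℝ) ≤ m := by exact_mod_cast hm0
    rw [← hm] at h
    linarith
  set θ : ℝ := 2 ^ (-(n * (H + γ))) with hθ
  have hθ0 : 0 < θ := by positivity
  obtain ⟨f, g, hfg⟩ := exists_binning (n := n) hP h1 hθ0 hm0
  refine ⟨m, f, fun k y i => φ (g k y i) (y i), hmle, ?_⟩
  rw [errorProb_eq_mass hW]
  have hw := blockWeight_nonneg hP (n := n)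
  have e1 : mass (blockWeight P) {b | (fun i => φ (g (f b.1) b.2 i) (b.2 i)) ≠
      fun i => φ (b.1 i) (b.2 i)} ≤ mass (blockWeight P) {b | g (f b.1) b.2 ≠ b.1} :=
    mass_mono hw fun b hb hcon => hb (by rw [hcon])
  have e2 : mass (blockWeight P) {b : (Fin n → S) × (Fin n → T) | blockCondWeight P b.1 b.2 < θ} ≤
      mass (blockWeight P) (atypicalSet P H γ n) :=
    mass_mono_of_ne_zero hw fun b hb hlt => mem_atypicalSet_of_lt hP hb hlt
  have e3 : 1 / (θ * m) ≤ 2 * (2 : ℝ) ^ (-(n * γ)) := by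
    have hm0' : (0 : ℝ) < m := by exact_mod_cast hm0
    rw [div_le_iff₀ (by positivity)]
    have : (2 : ℝ) ^ (-(n * γ)) * θ * 2 ^ ((n : ℝ) * R) = 1 := by
      rw [hθ, ← Real.rpow_add two_pos, ← Real.rpow_add two_pos, ← Real.rpow_zero 2]
      congr 1
      rw [hγ]
      ring
    rw [← this]
    calc _ ≤ (2 : ℝ) ^ (-(n * γ)) * θ * (2 * m) := by gcongr
      _ = _ := by ring
  linarith

theorem condEntropy_le_of_achievable [Nonempty S]
    (hW : IsMemoryless μ fun i ω => (X i ω, Y i ω)) {φ : S → T → V} {D : ℝ} (hD0 : 0 ≤ D)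
    (hD : ∀ s t t', jointWeight μ (X 0) (Y 0) s t ≤ D * jointWeight μ (X 0) (Y 0) s t')
    (hφ : ∀ s s' t, jointWeight μ (X 0) (Y 0) s t ≠ 0 → (∀ t, φ s t = φ s' t) → s' = s)
    {R : ℝ} (hR : Achievable μ X Y φ R) : condEntropy μ (X 0) (Y 0) ≤ R := by
  classical
  by_contra! hlt
  have hX : Measurable (X 0) := measurable_fst.comp (hW.measurable 0)
  have hY : Measurable (Y 0) := measurable_snd.comp (hW.measurable 0)
  set P := jointWeight μ (X 0) (Y 0) with hPdef
  set H := condEntropy μ (X 0) (Y 0) with hH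
  have hP : ∀ s t, 0 ≤ P s t := fun s t => measureReal_nonneg
  have h1 : ∑ t, sndMarginal P t = 1 := sum_sndMarginal_jointWeight hX hY
  -- Of the gap `4 * κ`, the Hamming ball uses `2 * κ` and typicality `κ`; the last `κ` gives
  -- exponential decay.
  obtain ⟨κ, hκ⟩ : ∃ κ, κ = (H - R) / 4 := ⟨_, rfl⟩
  have hκ0 : 0 < κ := by linarith
  have hκ1 : (1 : ℝ) < 2 ^ κ := Real.one_lt_rpow one_lt_two hκ0
  obtain ⟨s, hs0, hs1, hs⟩ : ∃ s : ℝ, 0 < s ∧ s ≤ 1 ∧ 1 + Fintype.card S * s ≤ 2 ^ κ := by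
    have hc : (0 : ℝ) < Fintype.card S := by exact_mod_cast Fintype.card_pos
    refine ⟨min 1 ((2 ^ κ - 1) / Fintype.card S), lt_min one_pos (by
      have := sub_pos.2 hκ1
      positivity), min_le_left _ _, ?_⟩
    have h := mul_le_mul_of_nonneg_left
      (min_le_right 1 (((2 : ℝ) ^ κ - 1) / Fintype.card S)) hc.le
    rw [mul_div_cancel₀ _ hc.ne'] at h
    linarith
  obtain ⟨δ, hδ0, hδ⟩ : ∃ δ : ℝ, 0 < δ ∧ s ^ (-δ) ≤ 2 ^ κ := by
    have ht : Tendsto (fun δ : ℝ => s ^ (-δ)) (nhdsWithin 0 (Set.Ioi 0)) (nhds (s ^ (-(0 : ℝ)))) :=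
      ((Real.continuous_const_rpow hs0.ne').comp continuous_neg).continuousAt.tendsto.mono_left
        nhdsWithin_le_nhds
    rw [neg_zero, Real.rpow_zero] at ht
    obtain ⟨δ, h, h'⟩ := ((ht.eventually (gt_mem_nhds hκ1)).and self_mem_nhdsWithin).exists
    exact ⟨δ, h', h.le⟩
  have hball : ∀ (n : ℕ) (z : Fin n → S),
      (({x : Fin n → S | (hammingDist x z : ℝ) ≤ n * δ}).ncard : ℝ) ≤ 2 ^ (n * (2 * κ)) := by
    intro n z
    have h := card_hammingBall_le z hs0 hs1 (δ := δ)
    rw [Set.ncard_eq_toFinset_card', Set.toFinset_ofPred]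
    refine h.trans ?_
    calc ((1 + Fintype.card S * s) * s ^ (-δ)) ^ n ≤ ((2 : ℝ) ^ κ * 2 ^ κ) ^ n := by gcongr
      _ = 2 ^ (n * (2 * κ)) := by
        rw [← Real.rpow_add two_pos, ← Real.rpow_natCast, ← Real.rpow_mul two_pos.le]
        congr 1
        ring
  set M := D * (Fintype.card T : ℝ) ^ 2 / δ with hM
  have hM0 : 0 ≤ M := by positivity
  have hA := (tendsto_mass_atypicalSet hW hκ0).eventually
    (gt_mem_nhds (show (0 : ℝ) < 1 / 4 by norm_num))
  have hB := (tendsto_two_rpow_neg_mul hκ0).eventually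
    (gt_mem_nhds (show (0 : ℝ) < 1 / 4 by norm_num))
  -- The tolerance keeps the Hamming-distance event below `1 / 4`; `M + 1` guards against `M = 0`.
  obtain ⟨n, hAn, hBn, ⟨m, f, g, hm, hfg⟩, hn⟩ := (hA.and (hB.and
    ((hR (1 / (4 * (M + 1))) (by positivity)).and (eventually_gt_atTop 0)))).exists
  rw [errorProb_eq_mass hW] at hfg
  have hw := blockWeight_nonneg hP (n := n)
  have e1 := mass_hammingDist_letterEstimate_le hP hD0 hD hφ f g hn hδ0
  have e1' : M * mass (blockWeight P) {b | g (f b.1) b.2 ≠ fun i => φ (b.1 i) (b.2 i)} ≤ 1 / 4 := by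
    refine (mul_le_mul_of_nonneg_left hfg hM0).trans ?_
    rw [mul_one_div, div_le_div_iff₀ (by positivity) (by norm_num)]
    linarith
  have e2 := mass_ball_le hP h1 f
    (fun k y => {x | (hammingDist x (letterEstimate φ g k y) : ℝ) ≤ n * δ})
    (θ := 2 ^ (-(n * (H - κ)))) (by positivity) (fun k y => hball n _)
  have e3 : (m : ℝ) * 2 ^ (n * (2 * κ)) * 2 ^ (-(n * (H - κ))) ≤ 2 ^ (-(n * κ)) := by
    calc (m : ℝ) * 2 ^ (n * (2 * κ)) * 2 ^ (-(n * (H - κ)))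
        ≤ 2 ^ ((n : ℝ) * R) * 2 ^ (n * (2 * κ)) * 2 ^ (-(n * (H - κ))) := by gcongr
      _ = 2 ^ (-(n * κ)) := by
        rw [← Real.rpow_add two_pos, ← Real.rpow_add two_pos]
        congr 1
        rw [hκ]
        ring
  have htot : mass (blockWeight P) (Set.univ : Set ((Fin n → S) × (Fin n → T))) = 1 := by
    rw [← measureReal_block hW]
    simp
  -- Every block in the support is badly estimated, in a ball with small conditional weight, or
  -- atypical. Each event has mass at most `1 / 4`, contradicting total mass one.
  have hcover := mass_mono_of_ne_zero hw
    (E := Set.univ)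
    (F := {b | n * δ ≤ (hammingDist b.1 (letterEstimate φ g (f b.1) b.2) : ℝ)} ∪
      ({b | b.1 ∈ {x | (hammingDist x (letterEstimate φ g (f b.1) b.2) : ℝ) ≤ n * δ} ∧
        blockCondWeight P b.1 b.2 ≤ 2 ^ (-(n * (H - κ)))} ∪ atypicalSet P H κ n)) (by
    intro b hb _
    by_cases hd : n * δ ≤ (hammingDist b.1 (letterEstimate φ g (f b.1) b.2) : ℝ)
    · exact Or.inl hd
    · by_cases hc : blockCondWeight P b.1 b.2 ≤ 2 ^ (-(n * (H - κ)))
      · exact Or.inr (Or.inl ⟨(not_le.1 hd).le, hc⟩)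
      · exact Or.inr (Or.inr (mem_atypicalSet_of_gt hP hb (not_le.1 hc))))
  have u1 := hcover.trans (mass_union_le hw _ _)
  have u2 := mass_union_le hw
    {b | b.1 ∈ {x | (hammingDist x (letterEstimate φ g (f b.1) b.2) : ℝ) ≤ n * δ} ∧
        blockCondWeight P b.1 b.2 ≤ 2 ^ (-(n * (H - κ)))} (atypicalSet P H κ n)
  linarith

/-- If all letters of the side information are comparably likely given each source letter and the
sections `φ s` separate the source letters, then the minimum rate for reconstructing `φ (X, Y)` is
`H(X | Y)`. -/
theorem isMinRate_condEntropy [Nonempty S]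
    (hW : IsMemoryless μ fun i ω => (X i ω, Y i ω)) {φ : S → T → V} {D : ℝ} (hD0 : 0 ≤ D)
    (hD : ∀ s t t', jointWeight μ (X 0) (Y 0) s t ≤ D * jointWeight μ (X 0) (Y 0) s t')
    (hφ : ∀ s s' t, jointWeight μ (X 0) (Y 0) s t ≠ 0 → (∀ t, φ s t = φ s' t) → s' = s) :
    IsMinRate μ X Y φ (condEntropy μ (X 0) (Y 0)) :=
  ⟨fun _ hR => condEntropy_le_of_achievable hW hD0 hD hφ hR,
    fun _ hr => le_of_forall_gt_imp_ge_of_dense fun _ hR =>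
      hr (achievable_of_condEntropy_lt hW φ hR)⟩

end Memoryless


/-! ### The linear model `Y = A + B * C`. -/

section Line

variable {K : Type*} [Field K] [Fintype K] [MeasurableSpace K] [MeasurableSingletonClass K]
  {Ω : Type*} [MeasurableSpace Ω] {μ : Measure Ω} [IsProbabilityMeasure μ]

-- For `b ≠ 0` the equation for `Y` can be solved for `C`, and independence applies; for `b = 0`
-- both sides vanish.
omit [Fintype K] in
theorem jointWeight_line {A B C : Ω → K} (hindep : iIndepFun ![A, B, C] μ)
    (hB : ∀ᵐ ω ∂μ, B ω ≠ 0) (s : K × K) (t : K) :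
    jointWeight μ (fun ω => (A ω, B ω)) (fun ω => A ω + B ω * C ω) s t =
      μ.real {ω | A ω = s.1} * μ.real {ω | B ω = s.2} * μ.real {ω | C ω = solveLine s t} := by
  obtain ⟨a, b⟩ := s
  have hB0 : μ.real {ω | B ω = 0} = 0 := by
    rw [measureReal_def, ENNReal.toReal_eq_zero_iff]
    exact Or.inl (by simpa [ae_iff] using hB)
  by_cases hb : b = 0
  · subst hb
    rw [hB0, mul_zero, zero_mul]
    refine le_antisymm (le_trans (measureReal_mono fun ω h => ?_) hB0.le) measureReal_nonneg
    exact (Prod.ext_iff.1 h.1).2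
  · have hind := hindep.measure_inter_preimage_eq_mul Finset.univ
      (sets := ![{a}, {b}, {solveLine (a, b) t}]) (by
        intro i _
        fin_cases i <;> exact measurableSet_singleton _)
    rw [Fin.prod_univ_three] at hind
    have hset : {ω | (A ω, B ω) = (a, b) ∧ A ω + B ω * C ω = t} =
        ⋂ i ∈ (Finset.univ : Finset (Fin 3)),
          ![A, B, C] i ⁻¹' (![{a}, {b}, {solveLine (a, b) t}] : Fin 3 → Set K) i := by
      ext ω
      simp only [Set.mem_ofPred_eq, Prod.mk.injEq, Finset.mem_univ, Set.iInter_true, Set.mem_iInter,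
        Set.mem_preimage, Fin.forall_fin_succ, solveLine]
      simp only [Matrix.cons_val_zero, Matrix.cons_val_succ, Set.mem_singleton_iff,
        IsEmpty.forall_iff, and_true, and_assoc]
      refine and_congr_right fun ha => and_congr_right fun hb' => ?_
      rw [ha, hb', eq_div_iff hb, eq_sub_iff_add_eq', mul_comm]
    rw [jointWeight, hset, measureReal_def, hind, ENNReal.toReal_mul, ENNReal.toReal_mul]
    rfl

omit [MeasurableSpace K] [MeasurableSingletonClass K] in
theorem sum_solveLine (G : K → ℝ) {b : K} (hb : b ≠ 0) (t : K) :
    ∑ a, G (solveLine (a, b) t) = ∑ c, G c :=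
  Equiv.sum_comp ((Equiv.subLeft t).trans (Equiv.divRight₀ b hb)) G

/-- For fixed `t` and `b ≠ 0`, `a ↦ (t - a) / b` permutes the field, so sums over `(a, b)` become
sums over `(b, c)`. The marginal of `Y` is then uniform, and the logarithm of the conditional weight
splits. -/
theorem condEntropy_line_of_uniform {A B C : Ω → K} (hAm : Measurable A) (hBm : Measurable B)
    (hCm : Measurable C) (hindep : iIndepFun ![A, B, C] μ) (hB : ∀ᵐ ω ∂μ, B ω ≠ 0)
    (hC : ∀ c : K, 0 < μ.real {ω | C ω = c})
    (hA : ∀ a : K, μ.real {ω | A ω = a} = 1 / (Fintype.card K : ℝ)) :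
    condEntropy μ (fun ω => (A ω, B ω)) (fun ω => A ω + B ω * C ω) =
      entropy μ B + entropy μ C := by
  have hXm : Measurable fun ω => (A ω, B ω) := hAm.prodMk hBm
  have hYm : Measurable fun ω => A ω + B ω * C ω :=
    (Measurable.of_discrete (f := fun p : K × K × K => p.1 + p.2.1 * p.2.2)).comp
      (hAm.prodMk (hBm.prodMk hCm))
  have hq : (0 : ℝ) < Fintype.card K := by exact_mod_cast Fintype.card_pos
  have hB1 := sum_measureReal_eq_one (μ := μ) hBm
  have hC1 := sum_measureReal_eq_one (μ := μ) hCm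
  have hB0 : μ.real {ω | B ω = 0} = 0 := by
    rw [measureReal_def, ENNReal.toReal_eq_zero_iff]
    exact Or.inl (by simpa [ae_iff] using hB)
  have hJ := jointWeight_line hindep hB
  rw [condEntropy_eq_sum hXm hYm]
  unfold entropy
  set J := jointWeight μ (fun ω => (A ω, B ω)) (fun ω => A ω + B ω * C ω)
  set pB : K → ℝ := fun b => μ.real {ω | B ω = b}
  set pC : K → ℝ := fun c => μ.real {ω | C ω = c}
  change ∑ b, pB b = 1 at hB1
  change ∑ c, pC c = 1 at hC1
  change ∀ c, 0 < pC c at hC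
  change pB 0 = 0 at hB0
  have hJ' : ∀ s t, J s t = 1 / (Fintype.card K : ℝ) * pB s.2 * pC (solveLine s t) := fun s t => by
    rw [hJ, hA]
  -- The slice `b = 0`, where the change of variable degenerates, must carry no weight.
  have hsum : ∀ (G : K → K → ℝ) (t : K), (∀ c, G 0 c = 0) →
      ∑ s : K × K, G s.2 (solveLine s t) = ∑ b, ∑ c, G b c := by
    intro G t hG
    rw [Fintype.sum_prod_type_right]
    refine Finset.sum_congr rfl fun b _ => ?_
    by_cases hb : b = 0
    · simp [hb, hG]
    · exact sum_solveLine (G b) hb t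
  have hmarg : ∀ t, sndMarginal J t = 1 / (Fintype.card K : ℝ) := by
    intro t
    simp only [sndMarginal, hJ']
    rw [hsum (fun b c => 1 / (Fintype.card K : ℝ) * pB b * pC c) t (by simp [hB0])]
    simp only [← Finset.mul_sum, hC1, hB1, mul_one]
  obtain ⟨L, hL⟩ : ∃ L : K → K → ℝ, L = fun b c => 1 / (Fintype.card K : ℝ) *
      (pC c * -(pB b * Real.logb 2 (pB b)) + pB b * -(pC c * Real.logb 2 (pC c))) := ⟨_, rfl⟩
  have hinfo : ∀ s t, J s t * condInfo J s t = L s.2 (solveLine s t) := by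
    intro s t
    have hcond : condWeight J s t = pB s.2 * pC (solveLine s t) := by
      rw [condWeight, hmarg, hJ']
      field_simp
    rw [condInfo, hcond, hJ', hL]
    by_cases hb : pB s.2 = 0
    · simp [hb]
    · rw [Real.logb_mul hb (hC _).ne']
      ring
  simp only [hinfo, hsum L _ fun c => by simp [hL, hB0]]
  rw [hL]
  simp only [← Finset.mul_sum, Finset.sum_add_distrib, ← Finset.sum_mul, hB1, hC1, one_mul,
    Finset.sum_neg_distrib, Finset.sum_const, Finset.card_univ, nsmul_eq_mul]
  field_simp
  rfl

end Line

end FunctionalCoding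

theorem lemma1 {K : Type*} [Field K] [Fintype K] [MeasurableSpace K] [MeasurableSingletonClass K]
    {Ω : Type*} [MeasurableSpace Ω] (μ : Measure Ω) [IsProbabilityMeasure μ]
    (A B C : ℕ → Ω → K)
    (hmem : FunctionalCoding.IsMemoryless μ (fun i ω => (A i ω, B i ω, C i ω)))
    (hindep : iIndepFun ![A 0, B 0, C 0] μ)
    (hB : ∀ᵐ ω ∂μ, B 0 ω ≠ 0)
    (hC : ∀ c : K, 0 < μ.real {ω | C 0 ω = c})
    (X : ℕ → Ω → K × K) (hX : X = fun i ω => (A i ω, B i ω))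
    (Y : ℕ → Ω → K) (hY : Y = fun i ω => A i ω + B i ω * C i ω) :
    FunctionalCoding.IsMinRate μ X Y FunctionalCoding.solveLine
        (FunctionalCoding.condEntropy μ (X 0) (Y 0)) ∧
      ((∀ a : K, μ.real {ω | A 0 ω = a} = 1 / (Fintype.card K : ℝ)) →
        FunctionalCoding.IsMinRate μ X Y FunctionalCoding.solveLine
          (FunctionalCoding.entropy μ (B 0) + FunctionalCoding.entropy μ (C 0))) := by
  subst hX hY
  have hm0 := hmem.measurable 0
  have hpair : Measurable fun p : K × K × K => ((p.1, p.2.1), p.1 + p.2.1 * p.2.2) :=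
    Measurable.of_discrete
  have hW : FunctionalCoding.IsMemoryless μ
      fun i ω => ((A i ω, B i ω), A i ω + B i ω * C i ω) :=
    { measurable := fun i => hpair.comp (hmem.measurable i)
      indep := hmem.indep.comp (fun _ p => ((p.1, p.2.1), p.1 + p.2.1 * p.2.2)) fun _ => hpair
      identDistrib := fun i => (hmem.identDistrib i).comp hpair }
  have hJ := FunctionalCoding.jointWeight_line hindep hB
  have hrate := FunctionalCoding.isMinRate_condEntropy hW
    -- This `D` dominates each inverse weight of `C`, hence every ratio of two such weights.
    (φ := FunctionalCoding.solveLine) (D := ∑ c : K, (μ.real {ω | C 0 ω = c})⁻¹)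
    (Finset.sum_nonneg fun c _ => inv_nonneg.2 (hC c).le)
    (fun s t t' => by
      rw [hJ, hJ, mul_left_comm]
      refine mul_le_mul_of_nonneg_left (measureReal_le_one.trans ?_)
        (mul_nonneg measureReal_nonneg measureReal_nonneg)
      rw [← inv_le_iff_one_le_mul₀ (hC _)]
      exact Finset.single_le_sum (f := fun c : K => (μ.real {ω | C 0 ω = c})⁻¹)
        (fun c _ => inv_nonneg.2 (hC c).le) (Finset.mem_univ _))
    (fun s s' t hne heq => by
      obtain ⟨a, b⟩ := s
      obtain ⟨a', b'⟩ := s'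
      have hb : b ≠ 0 := by
        rintro rfl
        refine hne ?_
        rw [hJ, mul_eq_zero, mul_eq_zero]
        refine Or.inl (Or.inr ?_)
        rw [measureReal_def, ENNReal.toReal_eq_zero_iff]
        exact Or.inl (by simpa [ae_iff] using hB)
      -- The section of `(a, b)` takes the value `0` at `a` and `1` at `a + b`; the second rules out
      -- `b' = 0`, and together they recover `a` and `b`.
      have h0 := heq a
      have h1 := heq (a + b)
      simp only [FunctionalCoding.solveLine, sub_self, zero_div, add_sub_cancel_left,
        div_self hb] at h0 h1
      have hb' : b' ≠ 0 := by
        rintro rfl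
        simp at h1
      have ha : a = a' := by
        rw [eq_comm, div_eq_zero_iff, or_iff_left hb', sub_eq_zero] at h0
        exact h0
      subst ha
      rw [add_sub_cancel_left, eq_comm, div_eq_one_iff_eq hb'] at h1
      rw [h1])
  refine ⟨hrate, fun hA => ?_⟩
  have hA0 : Measurable (A 0) := measurable_fst.comp hm0
  have hB0 : Measurable (B 0) := (measurable_fst.comp measurable_snd).comp hm0
  have hC0 : Measurable (C 0) := (measurable_snd.comp measurable_snd).comp hm0
  rw [← FunctionalCoding.condEntropy_line_of_uniform hA0 hB0 hC0 hindep hB hC hA]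
  exact hrate
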